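/- For a (discrete) group $G$ and $k\in\mathbb N=\{0,1,2,\dots\}$ let $C_b^k(G;\mathbb R)=\ell^\infty(G^k)$ be the space of bounded functions $G^k\to\mathbb R$ (equivalently, the topological dual of the free real vector space on $G^k$ with the $\ell^1$-norm), with coboundary $$(\delta f)(g_1,\dots,g_{k+1})=f(g_2,\dots,g_{k+1})+\sum_{j=1}^{k}(-1)^j f(g_1,\dots,g_jg_{j+1},\dots,g_{k+1})+(-1)^{k+1}f(g_1,\dots,g_k),$$ and let $H_b^k(G;\mathbb R)$ denote the cohomology of this complex in degree $k$ (bounded cohomology). The cup product $H_b^p(G;\mathbb R)\times H_b^q(G;\mathbb R)\to H_b^{p+q}(G;\mathbb R)$ is induced by $$(f\cup h)(g_1,\dots,g_{p+q})=(-1)^{pq}\,f(g_1,\dots,g_p)\,h(g_{p+1},\dots,g_{p+q}).$$ The bounded-cohomological dimension of $G$ is $\operatorname{bcd} G=\sup\{k\in\mathbb N : H_b^k(G;\mathbb R)\not\cong 0\}\in\mathbb N\cup\{\infty\}$. **Proposition.** For each $n\in\mathbb N$ let $G_n$ be a group with $H_b^2(G_n;\mathbb R)\not\cong 0$, and let $G$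 be either the full product $\prod_{n\in\mathbb N}G_n$ or its subgroup $\bigoplus_{n\in\mathbb N}G_n$ of families with finite support. Then $\operatorname{bcd} G=\infty$. More precisely, there is a sequence $(\varphi_n)_{n\in\mathbb N}$ in $H_b^2(G;\mathbb R)$ such that for all $n\in\mathbb N$ $$\varphi_0\cup\dots\cup\varphi_{n-1}\neq 0\in H_b^{2n}(G;\mathbb R),$$ where for $n=0$ the empty product is the unit class $1\in H_b^0(G;\mathbb R)$. -/

import Mathlib

/-! Bounded cohomology of discrete groups with trivial real coefficients, via the inhomogeneous
(bar) complex. -/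

namespace BddCoh

noncomputable section

universe u

variable (G : Type u)

/-- Bounded real cochains of degree `n`: the space `ℓ^∞(G ^ n)` of bounded functions on `G ^ n`.
Linear extension identifies it with the topological dual of the free real vector space on `G ^ n`
equipped with the `ℓ¹`-norm. -/
abbrev Cochain (n : ℕ) : Type u := lp (fun _ : Fin n → G => ℝ) ⊤

variable {G}

theorem memℓp_of_bound {X : Type*} {f : X → ℝ} {C : ℝ} (h : ∀ x, |f x| ≤ C) :
    Memℓp (E := fun _ : X => ℝ) f ⊤ :=
  memℓp_infty ⟨C, by rintro _ ⟨x, rfl⟩; exact h x⟩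

theorem Cochain.exists_bound {n : ℕ} (f : Cochain G n) : ∃ C : ℝ, ∀ g, |f g| ≤ C :=
  ⟨‖f‖, fun g => lp.norm_apply_le_norm ENNReal.top_ne_zero f g⟩

variable [Group G]

/-- The bar coboundary
`(δ f) (g₁, …, gₙ₊₁) = f (g₂, …, gₙ₊₁) + ∑_{1 ≤ j ≤ n} (-1)^j f (g₁, …, gⱼ gⱼ₊₁, …, gₙ₊₁)
  + (-1)^(n+1) f (g₁, …, gₙ)`
on arbitrary functions (`Fin.contractNth j` with `j` the last index drops the last entry). -/
def dFun {n : ℕ} (f : (Fin n → G) → ℝ) (g : Fin (n + 1) → G) : ℝ :=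
  f (fun i => g i.succ) +
    ∑ j : Fin (n + 1), (-1 : ℝ) ^ ((j : ℕ) + 1) * f (Fin.contractNth j (· * ·) g)

theorem dFun_bounded {n : ℕ} (f : Cochain G n) :
    Memℓp (E := fun _ : Fin (n + 1) → G => ℝ) (dFun (f : (Fin n → G) → ℝ)) ⊤ := by
  obtain ⟨C, hC⟩ := f.exists_bound
  refine memℓp_of_bound (C := C + ∑ _j : Fin (n + 1), C) fun g => ?_
  refine (abs_add_le _ _).trans (add_le_add (hC _) ?_)
  refine (Finset.abs_sum_le_sum_abs _ _).trans (Finset.sum_le_sum fun j _ => ?_)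
  simpa [abs_mul] using hC _

/-- The coboundary operator of the bounded cochain complex. -/
def d (n : ℕ) : Cochain G n →ₗ[ℝ] Cochain G (n + 1) where
  toFun f := ⟨dFun (f : (Fin n → G) → ℝ), dFun_bounded f⟩
  map_add' f h := by
    ext g
    simp only [dFun, lp.coeFn_add, Pi.add_apply, mul_add, Finset.sum_add_distrib]
    ring
  map_smul' c f := by
    ext g
    simp only [dFun, lp.coeFn_smul, Pi.smul_apply, smul_eq_mul, RingHom.id_apply, mul_add,
      Finset.mul_sum]
    congr 1
    exact Finset.sum_congr rfl fun j _ => by ring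

/-! ### Computations with sequences -/

/-- The `i`-th face of a sequence in the nerve of `G`. -/
def face (i : ℕ) (g : ℕ → G) (k : ℕ) : G :=
  if k + 1 < i then g k else if k + 1 = i then g k * g (k + 1) else g (k + 1)

theorem dFun_eq {n : ℕ} (f : (Fin n → G) → ℝ) (g : ℕ → G) :
    dFun f (fun i => g i) =
      ∑ i ∈ Finset.range (n + 2), (-1 : ℝ) ^ i * f (fun k => face i g k) := by
  rw [Finset.sum_range_succ', dFun, add_comm, Finset.sum_range]
  congr 1
  · refine Finset.sum_congr rfl fun j _ => ?_
    congr 2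
    funext k
    simp only [Fin.contractNth, face]
    grind
  · simp [face]

theorem exists_seq {n : ℕ} (g : Fin n → G) : ∃ g' : ℕ → G, g = fun i : Fin n => g' i :=
  ⟨fun k => if h : k < n then g ⟨k, h⟩ else 1, by funext i; simp⟩

theorem face_face {i j : ℕ} (h : j < i) (g : ℕ → G) :
    face j (face i g) = face (i - 1) (face j g) := by
  funext k
  simp only [face]
  grind

/-- The bounded cochains form a complex. -/
theorem d_d {n : ℕ} (f : Cochain G n) : d (n + 1) (d n f) = 0 := by
  ext g
  obtain ⟨g, rfl⟩ := exists_seq g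
  change dFun (dFun (f : (Fin n → G) → ℝ)) (fun i => g i) = 0
  rw [dFun_eq]
  simp only [dFun_eq, Finset.mul_sum]
  rw [← Finset.sum_product']
  refine Finset.sum_involution
    (fun a _ => if a.2 < a.1 then (a.2, a.1 - 1) else (a.2 + 1, a.1)) ?_ ?_ ?_ ?_
  · rintro ⟨i, j⟩ _
    by_cases h : j < i
    · obtain ⟨i, rfl⟩ : ∃ i', i = i' + 1 := ⟨i - 1, by omega⟩
      simp only [h, if_true, face_face h g, Nat.add_sub_cancel]
      ring
    · simp only [h, if_false, face_face (show i < j + 1 by omega) g, Nat.add_sub_cancel]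
      ring
  · rintro ⟨i, j⟩ _ _
    grind
  · rintro ⟨i, j⟩ hij
    simp only [Finset.mem_product, Finset.mem_range] at *
    grind
  · rintro ⟨i, j⟩ _
    grind

/-! ### Cohomology -/

variable (G)

/-- Bounded cocycles of degree `n`. -/
def cocycles (n : ℕ) : Submodule ℝ (Cochain G n) := LinearMap.ker (d n)

/-- Coboundaries of bounded cochains, in degree `n`. -/
def coboundaries : (n : ℕ) → Submodule ℝ (Cochain G n)
  | 0 => ⊥
  | n + 1 => LinearMap.range (d n)

/-- Bounded cohomology `H^n_b(G; ℝ)`. -/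
abbrev H (n : ℕ) : Type u := cocycles G n ⧸ (coboundaries G n).submoduleOf (cocycles G n)

/-- Bounded-cohomological dimension: the supremum in `ℕ ∪ {∞}` of all degrees with non-zero
bounded cohomology. -/
def bcd : ℕ∞ := sSup {m : ℕ∞ | ∃ n : ℕ, m = n ∧ Nontrivial (H G n)}

variable {G}

/-! ### Cup product -/

/-- The cup product of cochains: the pull-back along the diagonal `G → G × G` of the cross
product, that is
`(f ∪ h) (g₁, …, g_{p+q}) = (-1)^(p q) f (g₁, …, g_p) h (g_{p+1}, …, g_{p+q})`. -/
def cupFun {p q : ℕ} (f : (Fin p → G) → ℝ) (h : (Fin q → G) → ℝ) (g : Fin (p + q) → G) : ℝ :=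
  (-1 : ℝ) ^ (p * q) * (f (fun i => g (Fin.castAdd q i)) * h (fun j => g (Fin.natAdd p j)))

theorem cupFun_bounded {p q : ℕ} (f : Cochain G p) (h : Cochain G q) :
    Memℓp (E := fun _ : Fin (p + q) → G => ℝ)
      (cupFun (f : (Fin p → G) → ℝ) (h : (Fin q → G) → ℝ)) ⊤ := by
  obtain ⟨C, hC⟩ := f.exists_bound
  obtain ⟨D, hD⟩ := h.exists_bound
  refine memℓp_of_bound (C := C * D) fun g => ?_
  simp only [cupFun, abs_mul, abs_pow, abs_neg, abs_one, one_pow, one_mul]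
  exact mul_le_mul (hC _) (hD _) (abs_nonneg _) ((abs_nonneg _).trans (hC fun _ => 1))

/-- The cup product of bounded cochains. -/
def cupCochain (p q : ℕ) : Cochain G p →ₗ[ℝ] Cochain G q →ₗ[ℝ] Cochain G (p + q) :=
  LinearMap.mk₂ ℝ (fun f h => ⟨cupFun (f : (Fin p → G) → ℝ) (h : (Fin q → G) → ℝ),
      cupFun_bounded f h⟩)
    (fun f f' h => by ext g; simp only [lp.coeFn_add, Pi.add_apply, cupFun]; ring)
    (fun c f h => by ext g; simp [cupFun]; ring)
    (fun f h h' => by ext g; simp only [lp.coeFn_add, Pi.add_apply, cupFun]; ring)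
    (fun c f h => by ext g; simp [cupFun]; ring)

/-- The Leibniz rule, evaluated on (an initial part of) a sequence. -/
theorem leibniz {p q : ℕ} (f : (Fin p → G) → ℝ) (h : (Fin q → G) → ℝ) (g : ℕ → G) :
    dFun (cupFun f h) (fun i => g i) =
      (-1 : ℝ) ^ q * cupFun (dFun f) h (fun i => g i) +
        cupFun f (dFun h) (fun i : Fin (p + (q + 1)) => g i) := by
  have e1 : cupFun (dFun f) h (fun i => g i) = (-1 : ℝ) ^ ((p + 1) * q) *
      (dFun f (fun i => g i) * h (fun k : Fin q => g (p + 1 + k))) := rfl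
  have e2 : cupFun f (dFun h) (fun i : Fin (p + (q + 1)) => g i) = (-1 : ℝ) ^ (p * (q + 1)) *
      (f (fun i => g i) * dFun h (fun k : Fin (q + 1) => (fun m => g (p + m)) k)) := rfl
  have e3 : ∀ i, cupFun f h (fun k => face i g k) = (-1 : ℝ) ^ (p * q) *
      (f (fun k => face i g k) * h (fun k => face i g (p + k))) := fun _ => rfl
  have h1 : ∀ i < p + 1, (fun k : Fin q => face i g (p + k)) = fun k : Fin q => g (p + 1 + k) := by
    intro i hi
    funext k
    simp only [face]
    grind
  have h2 : ∀ i, (fun k : Fin p => face (p + 1 + i) g k) = fun k : Fin p => g k := by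
    intro i
    funext k
    simp only [face]
    grind
  have h3 : ∀ i, (fun k : Fin q => face (p + 1 + i) g (p + k)) =
      fun k : Fin q => face (i + 1) (fun m => g (p + m)) k := by
    intro i
    funext k
    simp only [face]
    grind
  have h4 : (fun k : Fin q => face 0 (fun m => g (p + m)) k) = fun k : Fin q => g (p + 1 + k) := by
    funext k
    simp only [face]
    grind
  have h5 : (fun k : Fin p => face (p + 1) g k) = fun k : Fin p => g k := h2 0
  rw [e1, e2, dFun_eq, dFun_eq, dFun_eq h (fun m => g (p + m)), Finset.sum_range_succ _ (p + 1),
    Finset.sum_range_succ' _ (q + 1), h4, h5,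
    show p + q + 2 = (p + 1) + (q + 1) by omega, Finset.sum_range_add]
  simp only [e3, h2, h3]
  have hA : ∑ i ∈ Finset.range (p + 1), (-1 : ℝ) ^ i * ((-1 : ℝ) ^ (p * q) *
      (f (fun k => face i g k) * h (fun k => face i g (p + k)))) =
      (-1 : ℝ) ^ (p * q) * ((∑ i ∈ Finset.range (p + 1), (-1 : ℝ) ^ i *
        f (fun k => face i g k)) * h (fun k : Fin q => g (p + 1 + k))) := by
    rw [Finset.sum_mul, Finset.mul_sum]
    refine Finset.sum_congr rfl fun i hi => ?_
    rw [h1 i (Finset.mem_range.1 hi)]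
    ring
  have hB : ∑ i ∈ Finset.range (q + 1), (-1 : ℝ) ^ (p + 1 + i) * ((-1 : ℝ) ^ (p * q) *
      (f (fun k : Fin p => g k) * h (fun k : Fin q => face (i + 1) (fun m => g (p + m)) k))) =
      (-1 : ℝ) ^ (p * (q + 1)) * (f (fun k : Fin p => g k) * ∑ i ∈ Finset.range (q + 1),
        (-1 : ℝ) ^ (i + 1) * h (fun k : Fin q => face (i + 1) (fun m => g (p + m)) k)) := by
    rw [Finset.mul_sum, Finset.mul_sum]
    exact Finset.sum_congr rfl fun i _ => by ring
  have hs : (-1 : ℝ) ^ q * (-1 : ℝ) ^ q = 1 := by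
    rw [← mul_pow]
    simp
  rw [hA, hB]
  simp only [add_mul, mul_add, pow_add, one_mul, mul_one, pow_one, pow_zero]
  linear_combination (-(-1 : ℝ) ^ (p * q) * ((∑ i ∈ Finset.range (p + 1), (-1 : ℝ) ^ i *
        f (fun k => face i g k)) * h (fun k : Fin q => g (p + 1 + k))) +
      (-1 : ℝ) ^ (p * q) * (-1 : ℝ) ^ p * f (fun k : Fin p => g k) * h (fun k : Fin q => g (p + 1 + k))) * hs

theorem mem_cocycles_iff {n : ℕ} (f : Cochain G n) :
    f ∈ cocycles G n ↔ dFun (f : (Fin n → G) → ℝ) = 0 := by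
  rw [cocycles, LinearMap.mem_ker, Subtype.ext_iff]
  rfl

theorem cup_mem_cocycles {p q : ℕ} (f : cocycles G p) (h : cocycles G q) :
    cupCochain p q f h ∈ cocycles G (p + q) := by
  obtain ⟨f, hf⟩ := f
  obtain ⟨h, hh⟩ := h
  rw [mem_cocycles_iff] at hf hh ⊢
  funext g
  obtain ⟨g, rfl⟩ := exists_seq g
  refine (leibniz _ _ g).trans ?_
  rw [hf, hh]
  simp [cupFun]

/-- The cup product of bounded cocycles. -/
def cupCocycle (p q : ℕ) : cocycles G p →ₗ[ℝ] cocycles G q →ₗ[ℝ] cocycles G (p + q) :=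
  LinearMap.mk₂ ℝ (fun f h => ⟨cupCochain p q f h, cup_mem_cocycles f h⟩)
    (fun f f' h => by ext1; simp)
    (fun c f h => by ext1; simp)
    (fun f h h' => by ext1; simp)
    (fun c f h => by ext1; simp)

theorem mem_coboundaries {m n : ℕ} (e : Cochain G m) (f : Cochain G n) (hn : n = m + 1)
    (he : ∀ g : ℕ → G, (f : (Fin n → G) → ℝ) (fun i => g i) =
      dFun (e : (Fin m → G) → ℝ) (fun i => g i)) : f ∈ coboundaries G n := by
  subst hn
  refine ⟨e, ?_⟩
  ext g
  obtain ⟨g, rfl⟩ := exists_seq g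
  exact (he g).symm

theorem cup_coboundary_left {p q : ℕ} (f : cocycles G p) (h : cocycles G q)
    (hf : (f : Cochain G p) ∈ coboundaries G p) :
    cupCochain p q f h ∈ coboundaries G (p + q) := by
  obtain ⟨f, hf0⟩ := f
  obtain ⟨h, hh⟩ := h
  rw [mem_cocycles_iff] at hh
  cases p with
  | zero =>
    have : f = 0 := hf
    simp [this]
  | succ p =>
    obtain ⟨e, rfl⟩ := hf
    refine mem_coboundaries ((-1 : ℝ) ^ q • cupCochain p q e h) _ (by omega) fun g => ?_
    have hs : (-1 : ℝ) ^ q * (-1 : ℝ) ^ q = 1 := by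
      rw [← mul_pow]
      simp
    have hl := leibniz (e : (Fin p → G) → ℝ) (h : (Fin q → G) → ℝ) g
    rw [hh] at hl
    have h0 : cupFun (e : (Fin p → G) → ℝ) (0 : (Fin (q + 1) → G) → ℝ) (fun i => g i) = 0 := by
      simp [cupFun]
    rw [h0, add_zero] at hl
    have hsm : dFun (((-1 : ℝ) ^ q • cupCochain p q e h : Cochain G (p + q)) :
        (Fin (p + q) → G) → ℝ) (fun i => g i) = (-1 : ℝ) ^ q *
        dFun (cupFun (e : (Fin p → G) → ℝ) (h : (Fin q → G) → ℝ)) (fun i => g i) :=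
      congrFun (congrArg Subtype.val ((d (p + q)).map_smul ((-1 : ℝ) ^ q) (cupCochain p q e h))) (fun i => g i)
    rw [hsm, hl, ← mul_assoc, hs, one_mul]
    rfl

theorem cup_coboundary_right {p q : ℕ} (f : cocycles G p) (h : cocycles G q)
    (hh : (h : Cochain G q) ∈ coboundaries G q) :
    cupCochain p q f h ∈ coboundaries G (p + q) := by
  obtain ⟨f, hf⟩ := f
  obtain ⟨h, hh0⟩ := h
  rw [mem_cocycles_iff] at hf
  cases q with
  | zero =>
    have : h = 0 := hh
    simp [this]
  | succ q =>
    obtain ⟨e, rfl⟩ := hh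
    refine mem_coboundaries (cupCochain p q f e) _ rfl fun g => ?_
    have hl := leibniz (f : (Fin p → G) → ℝ) (e : (Fin q → G) → ℝ) g
    rw [hf] at hl
    have h0 : cupFun (0 : (Fin (p + 1) → G) → ℝ) (e : (Fin q → G) → ℝ) (fun i => g i) = 0 := by
      simp [cupFun]
    rw [h0, mul_zero, zero_add] at hl
    exact hl.symm

/-- The cup product `H^p_b(G; ℝ) × H^q_b(G; ℝ) → H^(p+q)_b(G; ℝ)`. -/
def cup {p q : ℕ} : H G p →ₗ[ℝ] H G q →ₗ[ℝ] H G (p + q) :=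
  Submodule.liftQ _
    (LinearMap.flip (Submodule.liftQ _
      (LinearMap.flip ((cupCocycle p q).compr₂
        ((coboundaries G (p + q)).submoduleOf (cocycles G (p + q))).mkQ))
      (by
        intro h hh
        rw [LinearMap.mem_ker]
        ext1 f
        exact (Submodule.Quotient.mk_eq_zero _).2 (cup_coboundary_right f h hh))))
    (by
      intro f hf
      rw [LinearMap.mem_ker]
      refine LinearMap.ext fun h => ?_
      induction h using Submodule.Quotient.induction_on with
      | H h => exact (Submodule.Quotient.mk_eq_zero _).2 (cup_coboundary_left f h hf))

/-- On representatives, `cup` is the cup product of cocycles. -/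
theorem cup_mk {p q : ℕ} (f : cocycles G p) (h : cocycles G q) :
    cup (Submodule.Quotient.mk f : H G p) (Submodule.Quotient.mk h : H G q) =
      (Submodule.Quotient.mk (cupCocycle p q f h) : H G (p + q)) := rfl

variable (G) in
/-- The constant cocycle `1` of degree `0`. -/
def oneCocycle : cocycles G 0 :=
  ⟨⟨fun _ => 1, memℓp_of_bound (C := 1) fun _ => by simp⟩, by
    rw [mem_cocycles_iff]
    funext g
    simp [dFun]⟩

variable (G) in
/-- The unit class in `H^0_b(G; ℝ)`. -/
def one : H G 0 := Submodule.Quotient.mk (oneCocycle G)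

/-- The iterated cup product `φ 0 ∪ … ∪ φ (n - 1)` in degree `2 * n` of a sequence of classes of
degree two; the empty product is the unit class. -/
def cupChain (φ : ℕ → H G 2) : (n : ℕ) → H G (2 * n)
  | 0 => one G
  | n + 1 => cup (cupChain φ n) (φ n)

end

/-- The direct sum `⨁ₙ Gₙ`: the subgroup of `∏ₙ Gₙ` of families with finite support. -/
def directSum {ι : Type*} (G : ι → Type*) [∀ n, Group (G n)] : Subgroup (∀ n, G n) where
  carrier := {x | {n | x n ≠ 1}.Finite}
  one_mem' := by simp
  mul_mem' := by
    intro x y hx hy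
    refine (Set.Finite.union hx hy).subset fun n hn => ?_
    by_contra h
    simp only [Set.mem_union, Set.mem_ofPred_eq, not_or, not_not] at h
    exact hn (by simp [h.1, h.2])
  inv_mem' := by
    intro x hx
    simpa using hx

end BddCoh

/-!
The proof evaluates bounded cocycles against `ℓ¹`-cycles, one factor at a time.

Two facts make degree two special. Since `∂(x, x) = 2 x - x²`, the series
`∑ₖ 2^(-k-1) (x^(2^k), x^(2^k))` is an `ℓ¹`-chain with boundary `x`. On the one hand, evaluating a
bounded 2-cocycle on these chains gives a bounded function whose coboundary corrects the cocycle to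
one, `F`, that vanishes on the diagonal (`exists_cocycle_diagonal_eq_zero`); such an `F` is also
normalized, and if the class is non-zero then `F (a, a') ≠ 0` for some `a, a'`. On the other hand,
`(a, a')` can be completed by these series to an `ℓ¹`-cycle, on which `F` still takes the value
`F (a, a')`. The series enter only through `exists_two_mul_sub_comp`: for bounded `D` there is a
bounded `u` with `2 u x - u (x²) = D x`.

The slant product with a chain of a subgroup `A` commuting with a subgroup `S` is the dual of the
Eilenberg–Zilber shuffle map: `slantOne` and `slantTwo` insert one or two elements of `A` in all
positions into a tuple of `S`, with signs, and `slantTwo_dFun_succ` says that `slantTwo` commutes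
with the coboundary up to the boundary of the inserted chain. If `F` vanishes as soon as one
argument lies in `S`, then only one shuffle contributes to the slant product of `α ∪ F`, which is
`F (a, a') α` (`slantTwo_cupFun`). So a bounded primitive of `α ∪ F` on the tuples of a subgroup
containing `A` and `S` is turned by the `ℓ¹`-cycle above into a bounded primitive of `α` on the
tuples of `S` (`ExactOn.of_cupFun`).

For the theorem, `φ n` is the class of the cocycle `F` of the `n`-th factor, pulled back along the
projection. If `φ 0 ∪ … ∪ φ (n - 1)` vanished, then stripping off the last factor `n` times would
make the unit cocycle exact on the tuples of the trivial subgroup, that is `1 = 0`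
(`exists_cupChain_ne_zero`). The argument uses only the projections to the factors and the
commuting inclusions of the factors, so it covers the direct sum and the full product alike.
-/

namespace BddCoh

noncomputable section

open Matrix (vecCons vecTail)

/-! ### Slant products with chains of degree one and two -/

section Shuffle

variable {G : Type*}

/-- The bar coboundary of `f` at `(b, g₁, …, gₙ)` without its first term `f (g₁, …, gₙ)`,
defined by recursion on `n`; see `dFun_cons`. -/
def innerFaces [Mul G] (b : G) : {n : ℕ} → ((Fin n → G) → ℝ) → (Fin n → G) → ℝ
  | 0, f, g => -f g
  | _ + 1, f, g => -f (vecCons (b * g 0) (vecTail g)) -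
      innerFaces (g 0) (fun m => f (vecCons b m)) (vecTail g)

/-- The slant product of `f` with the chain `(a)`: the sum of
`(-1)^i f (g₁, …, gᵢ, a, gᵢ₊₁, …, gₙ)` over `0 ≤ i ≤ n`, by recursion on `n` according to whether
the first entry is `a` or `g₁`. -/
def slantOne (a : G) : {n : ℕ} → ((Fin (n + 1) → G) → ℝ) → (Fin n → G) → ℝ
  | 0, f, g => f (vecCons a g)
  | _ + 1, f, g => f (vecCons a g) - slantOne a (fun m => f (vecCons (g 0) m)) (vecTail g)

/-- The slant product of `f` with the chain `(a, a')`: the signed sum of the values of `f` at all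
`(2, n)`-shuffles of `(a, a')` and `(g₁, …, gₙ)`, by recursion on `n` according to whether the first
entry is `a` or `g₁`. Moving `g₁` past both `a` and `a'` does not change the sign. -/
def slantTwo (a a' : G) : {n : ℕ} → ((Fin (n + 2) → G) → ℝ) → (Fin n → G) → ℝ
  | 0, f, g => f (vecCons a (vecCons a' g))
  | _ + 1, f, g => slantOne a' (fun m => f (vecCons a m)) g +
      slantTwo a a' (fun m => f (vecCons (g 0) m)) (vecTail g)

theorem slantOne_cons (a b : G) {n : ℕ} (f : (Fin (n + 2) → G) → ℝ) (g : Fin n → G) :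
    slantOne a f (vecCons b g) =
      f (vecCons a (vecCons b g)) - slantOne a (fun m => f (vecCons b m)) g := by
  simp [slantOne]

theorem slantTwo_cons (a a' b : G) {n : ℕ} (f : (Fin (n + 3) → G) → ℝ) (g : Fin n → G) :
    slantTwo a a' f (vecCons b g) = slantOne a' (fun m => f (vecCons a m)) (vecCons b g) +
      slantTwo a a' (fun m => f (vecCons b m)) g := by
  simp [slantTwo]

theorem slantOne_add (a : G) {n : ℕ} (f h : (Fin (n + 1) → G) → ℝ) (g : Fin n → G) :
    slantOne a (fun m => f m + h m) g = slantOne a f g + slantOne a h g := by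
  induction n with
  | zero => rfl
  | succ n ih => simp only [slantOne, ih]; ring

theorem slantOne_neg (a : G) {n : ℕ} (f : (Fin (n + 1) → G) → ℝ) (g : Fin n → G) :
    slantOne a (fun m => -f m) g = -slantOne a f g := by
  induction n with
  | zero => rfl
  | succ n ih => simp only [slantOne, ih]; ring

theorem slantOne_sub (a : G) {n : ℕ} (f h : (Fin (n + 1) → G) → ℝ) (g : Fin n → G) :
    slantOne a (fun m => f m - h m) g = slantOne a f g - slantOne a h g := by
  simp only [sub_eq_add_neg, slantOne_add, slantOne_neg]

theorem slantTwo_add (a a' : G) {n : ℕ} (f h : (Fin (n + 2) → G) → ℝ) (g : Fin n → G) :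
    slantTwo a a' (fun m => f m + h m) g = slantTwo a a' f g + slantTwo a a' h g := by
  induction n with
  | zero => rfl
  | succ n ih => simp only [slantTwo, slantOne_add, ih]; ring

theorem slantTwo_neg (a a' : G) {n : ℕ} (f : (Fin (n + 2) → G) → ℝ) (g : Fin n → G) :
    slantTwo a a' (fun m => -f m) g = -slantTwo a a' f g := by
  induction n with
  | zero => rfl
  | succ n ih => simp only [slantTwo, slantOne_neg, ih]; ring

theorem slantTwo_sub (a a' : G) {n : ℕ} (f h : (Fin (n + 2) → G) → ℝ) (g : Fin n → G) :
    slantTwo a a' (fun m => f m - h m) g = slantTwo a a' f g - slantTwo a a' h g := by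
  simp only [sub_eq_add_neg, slantTwo_add, slantTwo_neg]

theorem abs_slantOne_le (a : G) {n : ℕ} {f : (Fin (n + 1) → G) → ℝ} {C : ℝ}
    (hf : ∀ m, |f m| ≤ C) (g : Fin n → G) : |slantOne a f g| ≤ (n + 1) * C := by
  induction n with
  | zero => simpa [slantOne] using hf _
  | succ n ih =>
    have h := ih (f := fun m => f (vecCons (g 0) m)) (fun m => hf _) (vecTail g)
    refine (abs_sub _ _).trans ?_
    push_cast
    linarith [hf (vecCons a g)]

theorem abs_slantTwo_le (a a' : G) {n : ℕ} {f : (Fin (n + 2) → G) → ℝ} {C : ℝ}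
    (hf : ∀ m, |f m| ≤ C) (g : Fin n → G) : |slantTwo a a' f g| ≤ (n + 1) * (n + 1) * C := by
  have hC : 0 ≤ C := (abs_nonneg _).trans (hf fun _ => a)
  induction n with
  | zero => simpa [slantTwo] using hf _
  | succ n ih =>
    have h := ih (f := fun m => f (vecCons (g 0) m)) (fun m => hf _) (vecTail g)
    have h' := abs_slantOne_le a' (f := fun m => f (vecCons a m)) (fun m => hf _) g
    refine (abs_add_le _ _).trans ?_
    push_cast at h' ⊢
    nlinarith [Nat.cast_nonneg (α := ℝ) n]

theorem slantOne_congr {S : Set G} {a : G} (ha : a ∈ S) {n : ℕ} {f h : (Fin (n + 1) → G) → ℝ}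
    (hfh : ∀ m, (∀ i, m i ∈ S) → f m = h m) {g : Fin n → G} (hg : ∀ i, g i ∈ S) :
    slantOne a f g = slantOne a h g := by
  induction n with
  | zero => exact hfh _ (Fin.cons ha hg)
  | succ n ih =>
    simp only [slantOne]
    rw [hfh _ (Fin.cons ha hg),
      ih (fun m hm => hfh (vecCons (g 0) m) (Fin.cons (hg 0) hm)) (g := vecTail g)
      fun i => hg i.succ]

theorem slantTwo_congr {S : Set G} {a a' : G} (ha : a ∈ S) (ha' : a' ∈ S) {n : ℕ}
    {f h : (Fin (n + 2) → G) → ℝ} (hfh : ∀ m, (∀ i, m i ∈ S) → f m = h m) {g : Fin n → G}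
    (hg : ∀ i, g i ∈ S) : slantTwo a a' f g = slantTwo a a' h g := by
  induction n with
  | zero => exact hfh _ (Fin.cons ha (Fin.cons ha' hg))
  | succ n ih =>
    simp only [slantTwo]
    rw [slantOne_congr ha' (fun m hm => hfh _ (Fin.cons ha hm)) hg,
      ih (fun m hm => hfh (vecCons (g 0) m) (Fin.cons (hg 0) hm)) (g := vecTail g)
      fun i => hg i.succ]

theorem cupFun_two_cons {p : ℕ} (α : (Fin (p + 1) → G) → ℝ) (F : (Fin 2 → G) → ℝ) (b : G)
    (m : Fin (p + 2) → G) : cupFun α F (vecCons b m : Fin (p + 1 + 2) → G) =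
      cupFun (fun l => α (vecCons b l)) F m := by
  have h1 : (fun i => (vecCons b m : Fin (p + 1 + 2) → G) (Fin.castAdd 2 i)) =
      vecCons b fun i => m (Fin.castAdd 2 i) := by
    funext i
    refine Fin.cases rfl (fun i => rfl) i
  have h2 : (fun j => (vecCons b m : Fin (p + 1 + 2) → G) (Fin.natAdd (p + 1) j)) =
      fun j => m (Fin.natAdd p j) := by
    funext j
    have : Fin.natAdd (p + 1) j = (Fin.natAdd p j).succ := Fin.ext (by simp; omega)
    rw [this]
    rfl
  rw [cupFun, cupFun, h1, h2]
  simp [pow_mul']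

theorem cupFun_two_zero (α : (Fin 0 → G) → ℝ) (F : (Fin 2 → G) → ℝ) (m : Fin 2 → G)
    (g : Fin 0 → G) : cupFun α F (m : Fin (0 + 2) → G) = α g * F m := by
  simp [cupFun, Subsingleton.elim _ g]

/-- In each insertion of a single `a` into a tuple of length `p + 1`, one of the last two entries
belongs to the tuple. -/
theorem slantOne_cupFun {p : ℕ} (α : (Fin p → G) → ℝ) (F : (Fin 2 → G) → ℝ) (a : G)
    (g : Fin (p + 1) → G) (hF : ∀ m i j, m i = g j → F m = 0) :
    slantOne (n := p + 1) a (cupFun (p := p) (q := 2) α F) g = 0 := by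
  induction p with
  | zero =>
    simp only [slantOne]
    rw [cupFun_two_zero _ _ _ (vecTail g), cupFun_two_zero _ _ _ (vecTail g),
      hF _ 1 0 (by simp), hF _ 0 0 (by simp)]
    simp
  | succ p ih =>
    rw [slantOne, cupFun_two_cons]
    simp only [cupFun_two_cons]
    rw [ih _ (vecTail g) fun m i j h => hF m i j.succ h]
    have : cupFun (fun l => α (vecCons a l)) F g = 0 := by
      rw [cupFun, hF _ 0 (Fin.natAdd p (0 : Fin 2)) rfl]
      simp
    rw [this, sub_zero]

/-- If `F` vanishes as soon as one argument is an entry of `g`, the only shuffle that contributes to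
the slant product of `α ∪ F` at `g` is the one with `a, a'` in the last two places. -/
theorem slantTwo_cupFun {p : ℕ} (α : (Fin p → G) → ℝ) (F : (Fin 2 → G) → ℝ) (a a' : G)
    (g : Fin p → G) (hF : ∀ m i j, m i = g j → F m = 0) :
    slantTwo a a' (cupFun α F) g = α g * F ![a, a'] := by
  induction p with
  | zero =>
    rw [slantTwo, cupFun_two_zero _ _ _ g, Subsingleton.elim g ![]]
  | succ p ih =>
    rw [slantTwo]
    simp only [cupFun_two_cons]
    rw [slantOne_cupFun _ _ _ _ hF, ih _ (vecTail g) fun m i j h => hF m i j.succ h, zero_add]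
    exact congrArg (fun l => α l * F ![a, a']) (Matrix.cons_head_tail g)

variable [Group G]

theorem innerFaces_cons (b c : G) {n : ℕ} (f : (Fin (n + 1) → G) → ℝ) (g : Fin n → G) :
    innerFaces b f (vecCons c g) =
      -f (vecCons (b * c) g) - innerFaces c (fun m => f (vecCons b m)) g := by
  simp [innerFaces]

theorem innerFaces_add (b : G) {n : ℕ} (f h : (Fin n → G) → ℝ) (g : Fin n → G) :
    innerFaces b (fun m => f m + h m) g = innerFaces b f g + innerFaces b h g := by
  induction n generalizing b with
  | zero => simp only [innerFaces]; ring
  | succ n ih => simp only [innerFaces, ih]; ring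

theorem innerFaces_neg (b : G) {n : ℕ} (f : (Fin n → G) → ℝ) (g : Fin n → G) :
    innerFaces b (fun m => -f m) g = -innerFaces b f g := by
  induction n generalizing b with
  | zero => simp only [innerFaces]
  | succ n ih => simp only [innerFaces, ih]; ring

theorem innerFaces_sub (b : G) {n : ℕ} (f h : (Fin n → G) → ℝ) (g : Fin n → G) :
    innerFaces b (fun m => f m - h m) g = innerFaces b f g - innerFaces b h g := by
  simp only [sub_eq_add_neg, innerFaces_add, innerFaces_neg]

theorem contractNth_succ_cons {n : ℕ} (j : Fin (n + 1)) (b : G) (g : Fin (n + 1) → G) :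
    Fin.contractNth j.succ (· * ·) (vecCons b g) = vecCons b (Fin.contractNth j (· * ·) g) := by
  funext k
  refine Fin.cases ?_ (fun k => ?_) k
  · simp [Fin.contractNth]
  · simp [Fin.contractNth]

theorem sum_contractNth_eq_innerFaces (b : G) {n : ℕ} (f : (Fin n → G) → ℝ) (g : Fin n → G) :
    ∑ j : Fin (n + 1), (-1 : ℝ) ^ ((j : ℕ) + 1) * f (Fin.contractNth j (· * ·) (vecCons b g)) =
      innerFaces b f g := by
  induction n generalizing b with
  | zero =>
    simp only [innerFaces, Fin.sum_univ_succ]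
    simp [Subsingleton.elim (Fin.contractNth 0 _ _) g]
  | succ n ih =>
    rw [Fin.sum_univ_succ]
    have h0 : Fin.contractNth 0 (· * ·) (vecCons b g) = vecCons (b * g 0) (vecTail g) := by
      funext k
      refine Fin.cases ?_ (fun k => ?_) k
      · simp [Fin.contractNth]
      · simp [Fin.contractNth, vecTail]
    obtain ⟨c, t, rfl⟩ : ∃ c t, g = vecCons c t :=
      ⟨_, _, (Matrix.cons_head_tail g).symm⟩
    simp only [contractNth_succ_cons, h0, innerFaces, ← ih]
    simp [pow_succ, sub_eq_add_neg, Finset.sum_neg_distrib]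

theorem dFun_cons (b : G) {n : ℕ} (f : (Fin n → G) → ℝ) (g : Fin n → G) :
    dFun f (vecCons b g) = f g + innerFaces b f g := by
  rw [dFun, sum_contractNth_eq_innerFaces]
  simp

/-- The compatibility of `slantOne` with the faces other than the first. Only `a` and the entries of
`g` have to commute: the face merging `b` and `a` is left over as `f (b a, g₁, …, gₙ)`. -/
theorem slantOne_innerFaces (a b : G) {n : ℕ} (f : (Fin (n + 1) → G) → ℝ) (g : Fin n → G)
    (h : ∀ i, Commute a (g i)) :
    slantOne a (innerFaces b f) g = f (vecCons b g) - f (vecCons (b * a) g) -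
      innerFaces b (fun m => f (vecCons a m)) g + innerFaces b (slantOne a f) g := by
  induction n generalizing b with
  | zero => simp [slantOne, innerFaces]; ring
  | succ n ih =>
    obtain ⟨c, t, rfl⟩ : ∃ c t, g = vecCons c t :=
      ⟨_, _, (Matrix.cons_head_tail g).symm⟩
    have hc : a * c = c * a := h 0
    have := ih c (fun m => f (vecCons b m)) t fun i => h i.succ
    simp only [slantOne_cons, innerFaces_cons, slantOne_sub, slantOne_neg, this, innerFaces_sub, hc]
    ring

/-- The compatibility of `slantTwo` with the faces other than the first. The term
`slantOne a' (innerFaces a f)` cannot be expanded by commuting `a` and `a'`, which need not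
commute. -/
theorem slantTwo_innerFaces (a a' b : G) {n : ℕ} (f : (Fin (n + 2) → G) → ℝ) (g : Fin n → G)
    (hb : Commute a b) (hb' : Commute a' b)
    (h : ∀ i, Commute a (g i)) (h' : ∀ i, Commute a' (g i)) :
    slantTwo a a' (innerFaces b f) g = innerFaces b (slantTwo a a' f) g -
      slantOne a' (innerFaces a f) (vecCons b g) - slantOne (a * a') f (vecCons b g) +
      slantOne a f (vecCons b g) := by
  induction n generalizing b with
  | zero =>
    have hb : a * b = b * a := hb
    have hb' : a' * b = b * a' := hb'
    simp [slantTwo, slantOne, innerFaces, hb, hb']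
    ring
  | succ n ih =>
    obtain ⟨c, t, rfl⟩ : ∃ c t, g = vecCons c t :=
      ⟨_, _, (Matrix.cons_head_tail g).symm⟩
    have hc : a * c = c * a := h 0
    have hc' : a' * c = c * a' := h' 0
    have hb : a * b = b * a := hb
    have hb' : a' * b = b * a' := hb'
    have := ih c (fun m => f (vecCons b m)) t (h 0) (h' 0) (fun i => h i.succ) (fun i => h' i.succ)
    have h2 := slantOne_innerFaces a' c (fun m => f (vecCons a (vecCons b m))) t fun i => h' i.succ
    simp only [slantTwo_cons, slantOne_cons, innerFaces_cons, slantOne_sub, slantOne_neg, this,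
      innerFaces_sub, innerFaces_add,
      slantTwo_sub, slantTwo_neg, h2, hc, hc', hb, hb']
    ring

/-- The case of degree zero of `slantTwo_dFun_succ`, where there is no further coboundary. -/
theorem slantTwo_dFun_zero (a a' : G) (f : (Fin 1 → G) → ℝ) (g : Fin 0 → G) :
    slantTwo a a' (dFun f) g = slantOne a' f g - slantOne (a * a') f g + slantOne a f g := by
  simp [slantTwo, slantOne, dFun_cons, innerFaces]
  ring

/-- The slant product with `(a, a')` commutes with the coboundary, up to the slant product with the
boundary `(a') - (a a') + (a)`, on tuples whose entries commute with `a` and `a'`. -/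
theorem slantTwo_dFun_succ (a a' : G) {n : ℕ} (f : (Fin (n + 2) → G) → ℝ) (g : Fin (n + 1) → G)
    (h : ∀ i, Commute a (g i)) (h' : ∀ i, Commute a' (g i)) :
    slantTwo a a' (dFun f) g = dFun (slantTwo a a' f) g +
      (slantOne a' f g - slantOne (a * a') f g + slantOne a f g) := by
  obtain ⟨b, t, rfl⟩ : ∃ b t, g = vecCons b t := ⟨_, _, (Matrix.cons_head_tail g).symm⟩
  have := slantTwo_innerFaces a a' b f t (h 0) (h' 0) (fun i => h i.succ) (fun i => h' i.succ)
  simp only [slantTwo_cons, dFun_cons, slantOne_add, slantTwo_add, this]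
  ring

end Shuffle

/-! ### The doubling trick -/

/-- For bounded `D` the equation `2 u - u ∘ σ = D` has a bounded solution, namely
`u x = ∑ₖ 2^(-k-1) D (σ^k x)`. -/
theorem exists_two_mul_sub_comp {X : Type*} (σ : X → X) (D : X → ℝ) {C : ℝ}
    (hD : ∀ x, |D x| ≤ C) : ∃ u : X → ℝ, (∀ x, |u x| ≤ C) ∧ ∀ x, 2 * u x - u (σ x) = D x := by
  have hb : ∀ x k, ‖(1 / 2 : ℝ) / 2 ^ k * D (σ^[k] x)‖ ≤ C / 2 / 2 ^ k := fun x k => by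
    rw [Real.norm_eq_abs, abs_mul, abs_of_pos (by positivity)]
    calc (1 / 2 : ℝ) / 2 ^ k * |D (σ^[k] x)| ≤ (1 / 2 : ℝ) / 2 ^ k * C := by
          gcongr
          exact hD _
      _ = C / 2 / 2 ^ k := by ring
  have hs : ∀ x, Summable fun k : ℕ => (1 / 2 : ℝ) / 2 ^ k * D (σ^[k] x) := fun x =>
    Summable.of_norm_bounded (hasSum_geometric_two' C).summable (hb x)
  refine ⟨fun x => ∑' k : ℕ, (1 / 2 : ℝ) / 2 ^ k * D (σ^[k] x), fun x => ?_, fun x => ?_⟩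
  · exact tsum_of_norm_bounded (hasSum_geometric_two' C) (hb x)
  · have h1 := (hs x).tsum_eq_zero_add
    have h2 : ∀ k : ℕ, (1 / 2 : ℝ) / 2 ^ (k + 1) * D (σ^[k + 1] x) =
        1 / 2 * ((1 / 2 : ℝ) / 2 ^ k * D (σ^[k] (σ x))) := fun k => by
      rw [Function.iterate_succ_apply, pow_succ]
      ring
    simp only [h2, tsum_mul_left] at h1
    simp only [h1]
    simp only [pow_zero, Function.iterate_zero, id_eq]
    ring

theorem eq_zero_of_two_mul_eq_comp {X : Type*} (σ : X → X) {R : X → ℝ} {C : ℝ}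
    (hR : ∀ x, |R x| ≤ C) (h : ∀ x, 2 * R x = R (σ x)) (x : X) : R x = 0 := by
  have hk : ∀ k : ℕ, 2 ^ k * R x = R (σ^[k] x) := fun k => by
    induction k with
    | zero => simp
    | succ k ih => rw [Function.iterate_succ_apply', ← h, ← ih]; ring
  by_contra h0
  obtain ⟨k, hk'⟩ := pow_unbounded_of_one_lt (C / |R x|) (one_lt_two (α := ℝ))
  rw [div_lt_iff₀ (abs_pos.2 h0)] at hk'
  have := hR (σ^[k] x)
  rw [← hk, abs_mul, abs_of_pos (by positivity)] at this
  linarith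

/-! ### Linearity and bounds of the coboundary -/

section

variable {G : Type*} [Group G]

theorem abs_dFun_le {n : ℕ} {f : (Fin n → G) → ℝ} {C : ℝ} (hf : ∀ g, |f g| ≤ C)
    (g : Fin (n + 1) → G) : |dFun f g| ≤ (n + 2) * C := by
  refine (abs_add_le _ _).trans ?_
  have : |∑ j : Fin (n + 1), (-1 : ℝ) ^ ((j : ℕ) + 1) * f (Fin.contractNth j (· * ·) g)| ≤
      ∑ _j : Fin (n + 1), C :=
    (Finset.abs_sum_le_sum_abs _ _).trans
      (Finset.sum_le_sum fun j _ => by simpa [abs_mul] using hf _)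
  rw [Finset.sum_const, Finset.card_univ, Fintype.card_fin, nsmul_eq_mul] at this
  push_cast at this
  linarith [hf fun i => g i.succ]

theorem dFun_add {n : ℕ} (f h : (Fin n → G) → ℝ) (g : Fin (n + 1) → G) :
    dFun (fun m => f m + h m) g = dFun f g + dFun h g := by
  simp only [dFun, mul_add, Finset.sum_add_distrib]
  ring

theorem dFun_const_mul {n : ℕ} (c : ℝ) (f : (Fin n → G) → ℝ) (g : Fin (n + 1) → G) :
    dFun (fun m => c * f m) g = c * dFun f g := by
  simp only [dFun, mul_add, Finset.mul_sum, mul_left_comm]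

theorem dFun_sub {n : ℕ} (f h : (Fin n → G) → ℝ) (g : Fin (n + 1) → G) :
    dFun (fun m => f m - h m) g = dFun f g - dFun h g := by
  simp only [dFun, mul_sub, Finset.sum_sub_distrib]
  ring

theorem dFun_one (u : (Fin 1 → G) → ℝ) (x y : G) :
    dFun u ![x, y] = u ![y] - u ![x * y] + u ![x] := by
  simp [dFun_cons, innerFaces]
  ring

theorem dFun_two (f : (Fin 2 → G) → ℝ) (x y z : G) :
    dFun f ![x, y, z] = f ![y, z] - f ![x * y, z] + f ![x, y * z] - f ![x, y] := by
  simp [dFun_cons, innerFaces]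
  ring

/-! ### Exactness on the tuples of a subset -/

/-- The function `f` on `G ^ n` agrees, on tuples with entries in `S`, with the coboundary of a
bounded function on `G ^ (n - 1)`; in degree `0`, where there is only the empty tuple, `f = 0`. -/
def ExactOn (S : Set G) : {n : ℕ} → ((Fin n → G) → ℝ) → Prop
  | 0, f => ∀ g, f g = 0
  | n + 1, f => ∃ ψ : (Fin n → G) → ℝ, (∃ C, ∀ m, |ψ m| ≤ C) ∧
      ∀ g, (∀ i, g i ∈ S) → dFun ψ g = f g

/-- Slant product with the `ℓ¹`-cycle completing `(a, a')`: it maps `α ∪ F` to `F (a, a') α`, and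
hence bounded primitives of `α ∪ F` to bounded primitives of `α`, up to the factor `F (a, a')`. -/
theorem ExactOn.of_cupFun {S S' A : Subgroup G} (hS : S ≤ S') (hA : A ≤ S')
    (hSA : ∀ x ∈ A, ∀ s ∈ S, Commute x s) {p : ℕ} {α : (Fin p → G) → ℝ} {F : (Fin 2 → G) → ℝ}
    (hF : ∀ m i, m i ∈ S → F m = 0) (hF' : ∀ x, F ![x, x] = 0) {a a' : G} (ha : a ∈ A)
    (ha' : a' ∈ A) (haF : F ![a, a'] ≠ 0) (h : ExactOn (S' : Set G) (cupFun α F)) :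
    ExactOn (S : Set G) α := by
  obtain ⟨ψ, ⟨C, hC⟩, hψ⟩ : ∃ ψ : (Fin (p + 1) → G) → ℝ, (∃ C, ∀ m, |ψ m| ≤ C) ∧
      ∀ g : Fin (p + 2) → G, (∀ i, g i ∈ (S' : Set G)) → dFun ψ g = cupFun α F g := h
  have key : ∀ x ∈ A, ∀ y ∈ A, ∀ g : Fin p → G, (∀ i, g i ∈ S) →
      slantTwo x y (dFun ψ) g = α g * F ![x, y] := fun x hx y hy g hg => by
    rw [slantTwo_congr (S := (S' : Set G)) (hA hx) (hA hy) hψ fun i => hS (hg i)]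
    exact slantTwo_cupFun α F x y g fun m i j hm => hF m i (hm ▸ hg j)
  cases p with
  | zero =>
    intro g
    -- `2 (x) - (x²)` is the boundary of `(x, x)`, on which `F` vanishes; boundedness forces the
    -- values of `ψ` on `A` to vanish.
    have e : ∀ x : A, slantOne (x : G) ψ g = 0 := by
      refine eq_zero_of_two_mul_eq_comp (fun x : A => x * x) (C := C) (fun x => ?_) fun x => ?_
      · simpa using abs_slantOne_le (x : G) hC g
      · have := key x x.2 x x.2 g fun i => i.elim0
        rw [slantTwo_dFun_zero, hF'] at this
        push_cast
        linarith
    have := key a ha a' ha' g fun i => i.elim0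
    have e1 := e ⟨a, ha⟩
    have e2 := e ⟨a', ha'⟩
    have e3 := e ⟨a * a', mul_mem ha ha'⟩
    simp only at e1 e2 e3
    rw [slantTwo_dFun_zero, e1, e2, e3] at this
    simpa [haF] using this.symm
  | succ p =>
    -- `U b x` is the value at `b` of the slant product of `ψ` with the `ℓ¹`-chain bounding `(x)`.
    have hU : ∀ b : Fin p → G, ∃ u : A → ℝ, (∀ x, |u x| ≤ (p + 1) * (p + 1) * C) ∧
        ∀ x, 2 * u x - u (x * x) = slantTwo (x : G) x ψ b := fun b =>
      exists_two_mul_sub_comp (fun x : A => x * x) _ fun x => abs_slantTwo_le _ _ hC b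
    choose U hU1 hU2 using hU
    -- Both terms are bounded in `x`, and their sum `R` satisfies `2 R x = R (x²)`; this replaces an
    -- exchange of the coboundary with the series defining `U`.
    have e : ∀ g : Fin (p + 1) → G, (∀ i, g i ∈ S) → ∀ x : A,
        slantOne (x : G) ψ g + dFun (fun b => U b x) g = 0 := by
      intro g hg
      refine eq_zero_of_two_mul_eq_comp (fun x : A => x * x)
        (C := (p + 1 + 1) * C + (p + 2) * ((p + 1) * (p + 1) * C)) (fun x => ?_) fun x => ?_
      · refine (abs_add_le _ _).trans (add_le_add ?_ (abs_dFun_le (fun b => hU1 b x) g))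
        simpa using abs_slantOne_le (x : G) hC g
      · have := key x x.2 x x.2 g hg
        rw [slantTwo_dFun_succ _ _ _ _ (fun i => hSA x x.2 _ (hg i))
          (fun i => hSA x x.2 _ (hg i)), hF',
          show slantTwo (x : G) x ψ = fun b => 2 * U b x - U b (x * x) from
            funext fun b => (hU2 b x).symm, dFun_sub, dFun_const_mul] at this
        push_cast
        linarith
    let y : A := ⟨a, ha⟩
    let y' : A := ⟨a', ha'⟩
    refine ⟨fun b => (F ![a, a'])⁻¹ * (slantTwo a a' ψ b - (U b y' - U b (y * y') + U b y)),
      ⟨|(F ![a, a'])⁻¹| * (4 * ((p + 1) * (p + 1) * C)), fun b => ?_⟩, fun g hg => ?_⟩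
    · rw [abs_mul]
      refine mul_le_mul_of_nonneg_left ?_ (abs_nonneg _)
      have h1 := abs_le.1 (abs_slantTwo_le a a' hC b)
      have h2 := abs_le.1 (hU1 b y)
      have h3 := abs_le.1 (hU1 b y')
      have h4 := abs_le.1 (hU1 b (y * y'))
      rw [abs_le]
      constructor <;> linarith
    · have := key a ha a' ha' g hg
      rw [slantTwo_dFun_succ _ _ _ _ (fun i => hSA a ha _ (hg i))
        (fun i => hSA a' ha' _ (hg i))] at this
      have e1 := e g hg y
      have e2 := e g hg y'
      have e3 := e g hg (y * y')
      simp only [y, y', Subgroup.coe_mul] at e1 e2 e3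
      rw [dFun_const_mul, dFun_sub, dFun_add, dFun_sub, inv_mul_eq_iff_eq_mul₀ haF,
        mul_comm, ← this]
      linarith

/-! ### Representatives of classes of degree two -/

/-- A non-zero class of degree two has a representative that vanishes on the diagonal, hence is
normalized; as it is not a coboundary, it takes a non-zero value. -/
theorem exists_cocycle_diagonal_eq_zero (h : Nontrivial (H G 2)) :
    ∃ F : cocycles G 2, (∀ x, (F : Cochain G 2) ![x, x] = 0) ∧
      (∀ x, (F : Cochain G 2) ![1, x] = 0) ∧ (∀ x, (F : Cochain G 2) ![x, 1] = 0) ∧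
      ∃ a a', (F : Cochain G 2) ![a, a'] ≠ 0 := by
  obtain ⟨c, hc⟩ := exists_ne (0 : H G 2)
  induction c using Submodule.Quotient.induction_on with
  | H f =>
  obtain ⟨C, hC⟩ := (f : Cochain G 2).exists_bound
  obtain ⟨u, hu1, hu2⟩ := exists_two_mul_sub_comp (fun x : G => x * x)
    (fun x => (f : Cochain G 2) ![x, x]) fun x => hC _
  let e : Cochain G 1 := ⟨fun m => u (m 0), memℓp_of_bound fun m => hu1 _⟩
  have he : ∀ x y, d 1 e ![x, y] = u y - u (x * y) + u x := fun x y => dFun_one _ x y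
  let F : cocycles G 2 := f - ⟨d 1 e, d_d e⟩
  have hFv : ∀ x y, (F : Cochain G 2) ![x, y] =
      (f : Cochain G 2) ![x, y] - (u y - u (x * y) + u x) := fun x y => by
    rw [← he]; rfl
  have hd : ∀ x, (F : Cochain G 2) ![x, x] = 0 := fun x => by
    rw [hFv, ← hu2]; ring
  have hz : ∀ x y z, dFun ((F : Cochain G 2) : (Fin 2 → G) → ℝ) ![x, y, z] = 0 := fun x y z =>
    congrFun ((mem_cocycles_iff _).1 F.2) _
  refine ⟨F, hd, fun x => ?_, fun x => ?_, ?_⟩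
  · have := hz 1 1 x
    rw [dFun_two, hd] at this
    simpa using this
  · have := hz x 1 1
    rw [dFun_two, hd] at this
    simpa using this
  · by_contra! h0
    refine hc ((Submodule.Quotient.mk_eq_zero _).2 ⟨e, ?_⟩)
    ext g
    have hg : g = ![g 0, g 1] := by
      funext i
      fin_cases i <;> rfl
    have := h0 (g 0) (g 1)
    rw [hFv, ← he, ← hg] at this
    exact (sub_eq_zero.1 this).symm

/-! ### Cup products of classes pulled back from commuting factors -/

/-- The pull-back of a bounded cocycle along a group homomorphism. -/
def pullback {K : Type*} [Group K] (π : G →* K) {n : ℕ} (f : cocycles K n) : cocycles G n :=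
  ⟨⟨fun g => (f : Cochain K n) fun i => π (g i), by
    obtain ⟨C, hC⟩ := (f : Cochain K n).exists_bound
    exact memℓp_of_bound fun g => hC _⟩, by
    rw [mem_cocycles_iff]
    funext g
    have := congrFun ((mem_cocycles_iff _).1 f.2) fun i => π (g i)
    refine Eq.trans ?_ this
    simp only [dFun]
    congr 1
    refine Finset.sum_congr rfl fun j _ => ?_
    refine congrArg (fun t => (-1 : ℝ) ^ ((j : ℕ) + 1) * (f : Cochain K n) t) (funext fun k => ?_)
    simp only [Fin.contractNth]
    split_ifs <;> simp⟩

/-- The iterated cup product of cocycles that represents the corresponding `cupChain`. -/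
def chainCocycle (z : ℕ → cocycles G 2) : (n : ℕ) → cocycles G (2 * n)
  | 0 => oneCocycle G
  | n + 1 => cupCocycle (2 * n) 2 (chainCocycle z n) (z n)

theorem cupChain_mk (z : ℕ → cocycles G 2) (n : ℕ) :
    cupChain (fun n => Submodule.Quotient.mk (z n)) n =
      Submodule.Quotient.mk (chainCocycle z n) := by
  induction n with
  | zero => rfl
  | succ n ih => rw [cupChain, ih, cup_mk]; rfl

theorem exactOn_of_mem_coboundaries (S : Set G) {n : ℕ} {f : Cochain G n}
    (hf : f ∈ coboundaries G n) : ExactOn S (f : (Fin n → G) → ℝ) := by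
  cases n with
  | zero =>
    have : f = 0 := hf
    intro g
    simp [this]
  | succ n =>
    obtain ⟨e, rfl⟩ := hf
    exact ⟨e, e.exists_bound, fun g _ => rfl⟩

/-- Non-vanishing of iterated cup products for any group with commuting subgroups `K n` onto which
it retracts, each retraction killing the other subgroups. -/
theorem exists_cupChain_ne_zero {K : ℕ → Type*} [∀ n, Group (K n)]
    (hK : ∀ n, Nontrivial (H (K n) 2)) (π : ∀ n, G →* K n) (ι : ∀ n, K n →* G)
    (hπι : ∀ n x, π n (ι n x) = x) (hπι' : ∀ m n, m ≠ n → ∀ x, π m (ι n x) = 1)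
    (hι : ∀ m n, m ≠ n → ∀ x y, Commute (ι m x) (ι n y)) :
    ∃ φ : ℕ → H G 2, ∀ n, cupChain φ n ≠ 0 := by
  choose F hF hF1 hF2 a a' ha using fun n => exists_cocycle_diagonal_eq_zero (hK n)
  let z : ℕ → cocycles G 2 := fun n => pullback (π n) (F n)
  have hz : ∀ n x y, (z n : Cochain G 2) ![x, y] = (F n : Cochain (K n) 2) ![π n x, π n y] :=
    fun n x y => congrArg (F n : Cochain (K n) 2) (by funext i; fin_cases i <;> rfl)
  -- The subgroup generated by the first `n` factors.
  let S : ℕ → Subgroup G := fun n => ⨆ m : Set.Iio n, (ι m).range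
  have hle : ∀ {m n}, m < n → (ι m).range ≤ S n := fun {m n} h =>
    le_iSup (fun m : Set.Iio n => (ι m).range) ⟨m, h⟩
  have hπS : ∀ n, ∀ s ∈ S n, π n s = 1 := fun n s hs => by
    have : S n ≤ (π n).ker := iSup_le fun m => by
      rintro _ ⟨x, rfl⟩
      exact hπι' n m (ne_of_gt m.2) x
    exact this hs
  have hcomm : ∀ n, ∀ x ∈ (ι n).range, ∀ s ∈ S n, Commute x s := fun n x hx s hs => by
    obtain ⟨x, rfl⟩ := hx
    have : S n ≤ Subgroup.centralizer {ι n x} := iSup_le fun m => by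
      rintro _ ⟨y, rfl⟩
      rw [Subgroup.mem_centralizer_singleton_iff]
      exact hι m n (ne_of_lt m.2) y x
    exact ((Subgroup.mem_centralizer_singleton_iff.1 (this hs)) : Commute s (ι n x)).symm
  refine ⟨fun n => Submodule.Quotient.mk (z n), fun n h0 => ?_⟩
  rw [cupChain_mk, Submodule.Quotient.mk_eq_zero] at h0
  have hex : ExactOn (S n : Set G)
      ((chainCocycle z n : Cochain G (2 * n)) : (Fin (2 * n) → G) → ℝ) :=
    exactOn_of_mem_coboundaries _ h0
  clear h0
  induction n with
  | zero => exact one_ne_zero (hex fun _ => 1)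
  | succ n ih =>
    refine ih (ExactOn.of_cupFun (S' := S (n + 1)) (A := (ι n).range)
      (F := ((z n : Cochain G 2) : (Fin 2 → G) → ℝ))
      (iSup_le fun m => hle (Nat.lt_succ_of_lt m.2)) (hle n.lt_succ_self) (hcomm n)
      (fun m i hm => ?_) (fun x => ?_) ⟨a n, rfl⟩ ⟨a' n, rfl⟩ ?_ hex)
    · have hm' : m = ![m 0, m 1] := by
        funext i
        fin_cases i <;> rfl
      rw [hm', hz]
      have := hπS n _ hm
      fin_cases i
      · exact (congrArg (fun t => (F n : Cochain (K n) 2) ![t, π n (m 1)]) this).trans (hF1 n _)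
      · exact (congrArg (fun t => (F n : Cochain (K n) 2) ![π n (m 0), t]) this).trans (hF2 n _)
    · rw [hz, hF]
    · rw [hz, hπι, hπι]
      exact ha n

theorem bcd_eq_top {φ : ℕ → H G 2} (hφ : ∀ n, cupChain φ n ≠ 0) : bcd G = ⊤ := by
  refine ENat.eq_top_iff_forall_ge.2 fun n => ?_
  refine le_trans ?_ (le_sSup ⟨2 * n, rfl, nontrivial_of_ne _ _ (hφ n)⟩)
  exact_mod_cast (by omega : n ≤ 2 * n)

end

end
end BddCoh

open BddCoh in
theorem proposition1p3 (G : ℕ → Type*) [∀ n, Group (G n)]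
    (hG : ∀ n, Nontrivial (H (G n) 2)) :
    (bcd (directSum G) = ⊤ ∧
      ∃ φ : ℕ → H (directSum G) 2, ∀ n : ℕ, cupChain φ n ≠ 0) ∧
    (bcd (∀ n, G n) = ⊤ ∧
      ∃ φ : ℕ → H (∀ n, G n) 2, ∀ n : ℕ, cupChain φ n ≠ 0) := by
  have hcomm : ∀ m n, m ≠ n → ∀ (x : G m) (y : G n),
      Commute (MonoidHom.mulSingle G m x) (MonoidHom.mulSingle G n y) :=
    fun m n h x y => Pi.mulSingle_commute h x y
  have h1 : ∃ φ : ℕ → H (directSum G) 2, ∀ n : ℕ, cupChain φ n ≠ 0 := by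
    refine exists_cupChain_ne_zero hG (fun n => (Pi.evalMonoidHom G n).comp (directSum G).subtype)
      (fun n => (MonoidHom.mulSingle G n).codRestrict (directSum G) fun x => ?_)
      (fun n x => Pi.mulSingle_eq_same n x) (fun m n h x => Pi.mulSingle_eq_of_ne h x)
      fun m n h x y => Subtype.ext (hcomm m n h x y)
    refine (Set.finite_singleton n).subset fun m hm => ?_
    by_contra h
    exact hm (Pi.mulSingle_eq_of_ne h x)
  have h2 : ∃ φ : ℕ → H (∀ n, G n) 2, ∀ n : ℕ, cupChain φ n ≠ 0 :=
    exists_cupChain_ne_zero hG (Pi.evalMonoidHom G) (MonoidHom.mulSingle G)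
      (fun n x => Pi.mulSingle_eq_same n x) (fun m n h x => Pi.mulSingle_eq_of_ne h x) hcomm
  exact ⟨⟨h1.elim fun _ h => bcd_eq_top h, h1⟩, h2.elim fun _ h => bcd_eq_top h, h2⟩
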